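/- For $n\ge 1$ let $M_n$ be the algebra of complex $n\times n$ matrices, and let $M$ be the $C^*$-algebra of all sequences $x=(x_n)_{n\ge1}$ with $x_n\in M_n$ and $\|x\|=\sup_n\|x_n\|<\infty$ (operator norms, coordinatewise operations). A projection $p=p^*=p^2\in M$ is called abelian if $pMp$ is commutative; let $I_{ab}$ be the norm-closed two-sided ideal of $M$ generated by the abelian projections. A pure state of $M$ is an extreme point of the set of states of $M$. A positive functional on $M$ is normal if it preserves suprema of upward directed sets that have a supremum, and a state $f$ of $M$ is singular if the only normal positive functional $g$ on $M$ with $g\le f$ is $g=0$. **Theorem.** The set of all singular pure states $f$ of $M$ that take a nonzero value on $I_{ab}$ (that is, $f(x)\neq 0$ for some $x\in I_{ab}$) is relatively weak* open and weak* dense in the set of all singular pure states of $M$. -/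

import Mathlib

open scoped Matrix.Norms.L2Operator ENNReal ComplexOrder

namespace KadisonSinger

noncomputable section

/-- The algebra `M`: the `ℓ^∞` direct sum of the full matrix algebras `M_1, M_2, M_3, …` over `ℂ`.
Its elements are the sequences `x = (x_n)` of matrices (the summand with index `n : ℕ` has size
`n + 1`) that are bounded in operator norm; the operations are coordinatewise and
`‖x‖ = sup_n ‖x_n‖`. -/
def M : Type := lp (fun n : ℕ => Matrix (Fin (n + 1)) (Fin (n + 1)) ℂ) ∞

/-- The C⋆-algebra structure that Mathlib puts on the `ℓ^∞` direct sum. -/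
instance instCStarAlgebraM : CStarAlgebra M :=
  { (inferInstance : NonUnitalCStarAlgebra
      (lp (fun n : ℕ => Matrix (Fin (n + 1)) (Fin (n + 1)) ℂ) ∞)),
    (lp.inftyNormedRing : NormedRing
      (lp (fun n : ℕ => Matrix (Fin (n + 1)) (Fin (n + 1)) ℂ) ∞)),
    (lp.inftyNormedAlgebra : NormedAlgebra ℂ
      (lp (fun n : ℕ => Matrix (Fin (n + 1)) (Fin (n + 1)) ℂ) ∞)) with }

/-- The usual order of a C⋆-algebra: `a ≤ b` iff `b - a` is self-adjoint with spectrum in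
`[0, ∞)`. -/
instance instPartialOrderM : PartialOrder M := CStarAlgebra.spectralOrder M

instance instStarOrderedRingM : StarOrderedRing M := CStarAlgebra.spectralOrderedRing M

/-- A bounded linear functional is positive if it is nonnegative on positive elements. (The order
on `ℂ` is the one with `0 ≤ z` iff `z` is a nonnegative real.) -/
def IsPositive (f : WeakDual ℂ M) : Prop :=
  ∀ a : M, 0 ≤ a → 0 ≤ f a

/-- The states of `M`, inside the dual of `M` with its weak* topology. -/
def states : Set (WeakDual ℂ M) :=
  {f | IsPositive f ∧ f 1 = 1}

/-- The pure states of `M` are the extreme points of the convex set of states. -/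
def pureStates : Set (WeakDual ℂ M) :=
  states.extremePoints ℝ

/-- A functional (used below for positive ones) is normal if it preserves the suprema of upward
directed sets that have a supremum. -/
def IsNormal (f : WeakDual ℂ M) : Prop :=
  ∀ (S : Set M) (a : M), S.Nonempty → DirectedOn (· ≤ ·) S → IsLUB S a →
    IsLUB (f '' S) (f a)

/-- A functional (used below for states) is singular if it majorizes no nonzero normal positive
functional. -/
def IsSingular (f : WeakDual ℂ M) : Prop :=
  ∀ g : WeakDual ℂ M, IsPositive g → IsNormal g → IsPositive (f - g) → g = 0

/-- The singular pure states of `M`; as a subtype, it carries the relative weak* topology. -/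
def singularPureStates : Set (WeakDual ℂ M) :=
  {f | f ∈ pureStates ∧ IsSingular f}

/-- A projection `p` of `M` is abelian if the algebra `p M p` is commutative. -/
def IsAbelianProjection (p : M) : Prop :=
  IsStarProjection p ∧ ∀ x y : M, Commute (p * x * p) (p * y * p)

/-- The ideal `I_ab`: the norm-closed two-sided ideal generated by the abelian projections. -/
def Iab : Set M :=
  closure (TwoSidedIdeal.span {p : M | IsAbelianProjection p} : Set M)

end

end KadisonSinger

/-! ### Extreme points of closed convex hulls -/

section Milman

variable {E : Type*} [AddCommGroup E] [Module ℝ E] [TopologicalSpace E] [IsTopologicalAddGroup E]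
  [ContinuousSMul ℝ E]

/-! Openness is immediate, since evaluations are weak* continuous. Density comes from the limits of
vector states along nonprincipal ultrafilters (`vectorLimitStates`). Such a limit takes the value 1
at the abelian projection built from its vectors. It is pure because compressing by that projection
turns every coordinate into a scalar, and singular because it kills every finite set of coordinates.

These limits are dense by duality. If a singular state were outside their closed convex hull,
Hahn-Banach would give a self-adjoint `c` with positive values on all limits and a negative one at
the state. But then all but finitely many coordinates of `c` are positive semidefinite
(`eventually_posSemidef_coord`), and a singular state ignores finitely many coordinates, so its
value at `c` is nonnegative. A singular pure state is therefore an extreme point of the hull, and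
Milman's theorem puts it in the closure of the limits. -/

theorem IsCompact.convexJoin {s t : Set E} (hs : IsCompact s) (ht : IsCompact t) :
    IsCompact (convexJoin ℝ s t) := by
  have h : _root_.convexJoin ℝ s t =
      (fun q : ℝ × E × E => (1 - q.1) • q.2.1 + q.1 • q.2.2) '' (Set.Icc 0 1 ×ˢ s ×ˢ t) := by
    ext x
    simp only [mem_convexJoin, segment_eq_image, Set.mem_image, Set.mem_prod, Prod.exists]
    constructor
    · rintro ⟨a, ha, b, hb, r, hr, rfl⟩
      exact ⟨r, a, b, ⟨hr, ha, hb⟩, rfl⟩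
    · rintro ⟨r, a, b, ⟨hr, ha, hb⟩, rfl⟩
      exact ⟨a, ha, b, hb, r, hr, rfl⟩
  rw [h]
  exact (isCompact_Icc.prod (hs.prod ht)).image (by fun_prop)

/-- Milman's partial converse to the Krein-Milman theorem. -/
theorem extremePoints_closedConvexHull_subset [T2Space E] [LocallyConvexSpace ℝ E] {s : Set E}
    (hs : IsCompact s) (hK : IsCompact (closedConvexHull ℝ s)) :
    (closedConvexHull ℝ s).extremePoints ℝ ⊆ s := by
  intro x hx
  by_contra hxs
  rw [mem_extremePoints_iff_forall_segment] at hx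
  -- Compactness reduces the claim to small pieces of `s`: extremality handles unions of two pieces,
  -- and a separating half-space handles a neighbourhood of each point.
  refine hs.induction_on (p := fun t => x ∉ closedConvexHull ℝ (t ∩ s)) ?_ ?_ ?_ ?_ ?_
  · simp [closedConvexHull_eq_closure_convexHull]
  · exact fun t u htu hu ht => hu ((closedConvexHull ℝ).monotone
      (Set.inter_subset_inter_left s htu) ht)
  · intro t u ht hu hxtu
    have hsub (v : Set E) : closedConvexHull ℝ (v ∩ s) ⊆ closedConvexHull ℝ s :=
      (closedConvexHull ℝ).monotone Set.inter_subset_right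
    have hcpt (v : Set E) : IsCompact (closedConvexHull ℝ (v ∩ s)) :=
      hK.of_isClosed_subset isClosed_closedConvexHull (hsub v)
    rw [Set.union_inter_distrib_right] at hxtu
    -- A convex join with the empty set is empty, so empty pieces are treated apart.
    rcases (t ∩ s).eq_empty_or_nonempty with h | h
    · rw [h, Set.empty_union] at hxtu
      exact hu hxtu
    rcases (u ∩ s).eq_empty_or_nonempty with h' | h'
    · rw [h', Set.union_empty] at hxtu
      exact ht hxtu
    have key : closedConvexHull ℝ (t ∩ s ∪ u ∩ s) ⊆
        convexJoin ℝ (closedConvexHull ℝ (t ∩ s)) (closedConvexHull ℝ (u ∩ s)) := by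
      refine closedConvexHull_min (Set.union_subset ?_ ?_)
        (convex_closedConvexHull.convexJoin convex_closedConvexHull)
        ((hcpt t).convexJoin (hcpt u)).isClosed
      · exact subset_closedConvexHull.trans
          (subset_convexJoin_left (h'.mono subset_closedConvexHull))
      · exact subset_closedConvexHull.trans
          (subset_convexJoin_right (h.mono subset_closedConvexHull))
    obtain ⟨a, ha, b, hb, hab⟩ := mem_convexJoin.1 (key hxtu)
    rcases hx.2 a (hsub t ha) b (hsub u hb) hab with rfl | rfl
    · exact ht ha
    · exact hu hb
  · intro y hy
    have hne : y ≠ x := fun h => hxs (h ▸ hy)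
    obtain ⟨φ, hφ⟩ := geometric_hahn_banach_point_point hne
    obtain ⟨c, hc, hc'⟩ := exists_between hφ
    refine ⟨{z | φ z ≤ c}, mem_nhdsWithin_of_mem_nhds ?_, fun hxc => ?_⟩
    · exact Filter.mem_of_superset ((isOpen_lt φ.continuous continuous_const).mem_nhds hc)
        fun z (hz : φ z < c) => hz.le
    · have : closedConvexHull ℝ ({z | φ z ≤ c} ∩ s) ⊆ {z | φ z ≤ c} :=
        closedConvexHull_min Set.inter_subset_left
          (convex_halfSpace_le φ.isLinear c)
          (isClosed_le φ.continuous continuous_const)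
      exact absurd (this hxc) (not_le.2 hc')
  · rw [Set.inter_self]
    exact hx.1

end Milman

/-! ### Coordinates, order and central projections of `M` -/

namespace KadisonSinger

noncomputable section

namespace M

/-- The `n`-th coordinate of an element of `M`. -/
def coord (n : ℕ) : M →⋆ₐ[ℂ] Matrix (Fin (n + 1)) (Fin (n + 1)) ℂ where
  toFun x := (show lp (fun n : ℕ => Matrix (Fin (n + 1)) (Fin (n + 1)) ℂ) ∞ from x).1 n
  map_one' := rfl
  map_mul' _ _ := rfl
  map_zero' := rfl
  map_add' _ _ := rfl
  commutes' _ := rfl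
  map_star' _ := rfl

theorem ext {x y : M} (h : ∀ n, coord n x = coord n y) : x = y :=
  lp.ext (funext h)

theorem norm_coord_le (x : M) (n : ℕ) : ‖coord n x‖ ≤ ‖x‖ :=
  lp.norm_apply_le_norm ENNReal.top_ne_zero _ n

theorem continuous_coord (n : ℕ) : Continuous (coord n) :=
  AddMonoidHomClass.continuous_of_bound (coord n) 1 fun x => by simpa using norm_coord_le x n

theorem norm_le {x : M} {C : ℝ} (h : ∀ n, ‖coord n x‖ ≤ C) : ‖x‖ ≤ C :=
  lp.norm_le_of_forall_le' C h

/-- The element of `M` with prescribed, uniformly bounded, coordinates. -/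
def ofBounded (x : ∀ n : ℕ, Matrix (Fin (n + 1)) (Fin (n + 1)) ℂ) (C : ℝ)
    (h : ∀ n, ‖x n‖ ≤ C) : M :=
  (⟨x, memℓp_infty ⟨C, by rintro _ ⟨n, rfl⟩; exact h n⟩⟩ :
    lp (fun n : ℕ => Matrix (Fin (n + 1)) (Fin (n + 1)) ℂ) ∞)

@[simp]
theorem coord_ofBounded (x : ∀ n : ℕ, Matrix (Fin (n + 1)) (Fin (n + 1)) ℂ) (C : ℝ)
    (h : ∀ n, ‖x n‖ ≤ C) (n : ℕ) : coord n (ofBounded x C h) = x n := rfl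

open MatrixOrder in
theorem posSemidef_coord {a : M} (ha : 0 ≤ a) (n : ℕ) : (coord n a).PosSemidef := by
  obtain ⟨b, rfl⟩ := CStarAlgebra.nonneg_iff_eq_star_mul_self.1 ha
  rw [map_mul, map_star]
  exact Matrix.posSemidef_conjTranspose_mul_self _

open MatrixOrder in
theorem nonneg_of_posSemidef {a : M} (h : ∀ n, (coord n a).PosSemidef) : 0 ≤ a := by
  have h' (n : ℕ) := CStarAlgebra.nonneg_iff_eq_star_mul_self.1 (h n).nonneg
  choose b hb using h'
  -- The C⋆-identity bounds the coordinatewise roots uniformly, so they assemble to an element of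
  -- `M`.
  have hbd (n : ℕ) : ‖b n‖ ≤ √‖a‖ := by
    apply Real.le_sqrt_of_sq_le
    rw [sq, ← CStarRing.norm_star_mul_self, ← hb]
    exact norm_coord_le a n
  have : a = star (ofBounded b _ hbd) * ofBounded b _ hbd :=
    ext fun n => by rw [map_mul, map_star, coord_ofBounded, hb]
  rw [this]
  exact star_mul_self_nonneg _

/-- The inclusion of the `n`-th summand. -/
def single (n : ℕ) : Matrix (Fin (n + 1)) (Fin (n + 1)) ℂ →ₗ[ℂ] M where
  toFun A := ofBounded (Pi.single n A) ‖A‖ fun k => by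
    by_cases h : k = n
    · subst h; simp
    · simp [Pi.single_eq_of_ne h]
  map_add' A B := ext fun k => by simp [Pi.single_add]
  map_smul' c A := ext fun k => by simp [Pi.single_smul]

theorem coord_single (n k : ℕ) (A : Matrix (Fin (n + 1)) (Fin (n + 1)) ℂ) :
    coord k (single n A) = (Pi.single n A : ∀ k, Matrix (Fin (k + 1)) (Fin (k + 1)) ℂ) k := rfl

@[simp]
theorem coord_single_self (n : ℕ) (A : Matrix (Fin (n + 1)) (Fin (n + 1)) ℂ) :
    coord n (single n A) = A := by
  simp [coord_single]

theorem coord_single_of_ne {n k : ℕ} (h : k ≠ n) (A : Matrix (Fin (n + 1)) (Fin (n + 1)) ℂ) :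
    coord k (single n A) = 0 := by
  simp [coord_single, Pi.single_eq_of_ne h]

theorem continuous_single (n : ℕ) : Continuous (single n) :=
  (single n).continuous_of_finiteDimensional

open Classical in
/-- The central projection whose coordinates are `1` on `s` and `0` off `s`. -/
def centralProj (s : Set ℕ) : M :=
  ofBounded (fun n => if n ∈ s then 1 else 0) 1 fun n => by split_ifs <;> simp

theorem coord_centralProj_of_mem {s : Set ℕ} {n : ℕ} (h : n ∈ s) :
    coord n (centralProj s) = 1 := by
  simp [centralProj, h]

theorem coord_centralProj_of_notMem {s : Set ℕ} {n : ℕ} (h : n ∉ s) :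
    coord n (centralProj s) = 0 := by
  simp [centralProj, h]

theorem isStarProjection_centralProj (s : Set ℕ) : IsStarProjection (centralProj s) := by
  constructor
  · refine ext fun n => ?_
    by_cases h : n ∈ s <;> simp [centralProj, h]
  · refine ext fun n => ?_
    by_cases h : n ∈ s <;> simp [centralProj, h, map_star]

theorem centralProj_mul_comm (s : Set ℕ) (x : M) : centralProj s * x = x * centralProj s := by
  refine ext fun n => ?_
  by_cases h : n ∈ s <;> simp [centralProj, h]

theorem centralProj_mul_nonneg (s : Set ℕ) {x : M} (hx : 0 ≤ x) : 0 ≤ centralProj s * x := by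
  refine nonneg_of_posSemidef fun n => ?_
  by_cases h : n ∈ s
  · simpa [coord_centralProj_of_mem h] using posSemidef_coord hx n
  · simpa [coord_centralProj_of_notMem h] using Matrix.PosSemidef.zero

theorem centralProj_add_compl (s : Set ℕ) : centralProj s + centralProj sᶜ = 1 := by
  refine ext fun n => ?_
  by_cases h : n ∈ s <;> simp [centralProj, h]

theorem single_coord (n : ℕ) (x : M) : single n (coord n x) = centralProj {n} * x := by
  refine ext fun k => ?_
  by_cases h : k = n
  · subst h; simp [coord_centralProj_of_mem]
  · rw [coord_single_of_ne h, map_mul, coord_centralProj_of_notMem (by simpa using h), zero_mul]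

end M

end

end KadisonSinger

/-! ### Cauchy-Schwarz for positive functionals -/

namespace PositiveLinearMap

variable {A : Type*} [CStarAlgebra A] [PartialOrder A] [StarOrderedRing A]

/-- The Cauchy-Schwarz inequality for positive functionals. -/
theorem norm_apply_mul_sq_le (f : A →ₚ[ℂ] ℂ) (a b : A) :
    ‖f (star a * b)‖ ^ 2 ≤ (f (star a * a)).re * (f (star b * b)).re := by
  have h := norm_inner_le_norm (𝕜 := ℂ) (f.toPreGNS a) (f.toPreGNS b)
  rw [preGNS_inner_def, preGNS_norm_def, preGNS_norm_def] at h
  simp only [ofPreGNS_toPreGNS] at h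
  have ha : 0 ≤ (f (star a * a)).re := (f.map_nonneg (star_mul_self_nonneg a)).1
  have hb : 0 ≤ (f (star b * b)).re := (f.map_nonneg (star_mul_self_nonneg b)).1
  calc ‖f (star a * b)‖ ^ 2 ≤ (√(f (star a * a)).re * √(f (star b * b)).re) ^ 2 := by gcongr
    _ = _ := by rw [mul_pow, Real.sq_sqrt ha, Real.sq_sqrt hb]

theorem norm_apply_le (f : A →ₚ[ℂ] ℂ) (a : A) : ‖f a‖ ≤ ‖f 1‖ * ‖a‖ := by
  have h := f.norm_apply_mul_sq_le 1 a
  rw [star_one, one_mul, one_mul] at h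
  refine le_of_sq_le_sq (h.trans ?_) (by positivity)
  calc (f 1).re * (f (star a * a)).re ≤ ‖f 1‖ * ‖f (star a * a)‖ :=
        mul_le_mul (Complex.re_le_norm _) (Complex.re_le_norm _)
          (f.map_nonneg (star_mul_self_nonneg a)).1 (norm_nonneg _)
    _ ≤ ‖f 1‖ * (‖f 1‖ * ‖star a * a‖) := by
        gcongr
        exact f.norm_apply_le_of_nonneg _ (star_mul_self_nonneg a)
    _ = _ := by rw [CStarRing.norm_star_mul_self]; ring

/-- A positive functional that vanishes on the complement of a projection `q` is determined by its
values on the corner of `q`. -/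
theorem apply_eq_apply_conj (f : A →ₚ[ℂ] ℂ) {q : A} (hq : IsStarProjection q)
    (h : f (1 - q) = 0) (x : A) : f x = f (q * x * q) := by
  have hr : star (1 - q) * (1 - q) = 1 - q := by
    rw [hq.one_sub.isSelfAdjoint.star_eq, hq.one_sub.isIdempotentElem.eq]
  have hright (y : A) : f (y * (1 - q)) = 0 := by
    have := f.norm_apply_mul_sq_le (star y) (1 - q)
    rw [star_star, hr, h, Complex.zero_re, mul_zero] at this
    simpa using le_antisymm this (sq_nonneg _)
  have hleft (y : A) : f ((1 - q) * y) = 0 := by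
    have := f.norm_apply_mul_sq_le (1 - q) y
    rw [hr, h, hq.one_sub.isSelfAdjoint.star_eq, Complex.zero_re, zero_mul] at this
    simpa using le_antisymm this (sq_nonneg _)
  have hx : x = q * x * q + (1 - q) * (x * q) + x * (1 - q) := by noncomm_ring
  conv_lhs => rw [hx, map_add, map_add, hleft, hright, add_zero, add_zero]

end PositiveLinearMap

/-! ### States, vector states and rank-one projections -/

namespace KadisonSinger

noncomputable section

open Filter Topology

/-- A positive functional on `M`, as a positive linear map. -/
def IsPositive.toPositiveLinearMap {f : WeakDual ℂ M} (hf : IsPositive f) : M →ₚ[ℂ] ℂ :=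
  .mk₀ (WeakDual.toStrongDual f).toLinearMap hf

theorem IsPositive.mono {f : WeakDual ℂ M} (hf : IsPositive f) {a b : M} (h : a ≤ b) :
    f a ≤ f b := by
  simpa using hf (b - a) (sub_nonneg.2 h)

theorem IsPositive.norm_apply_le {f : WeakDual ℂ M} (hf : IsPositive f) (x : M) :
    ‖f x‖ ≤ ‖f 1‖ * ‖x‖ :=
  hf.toPositiveLinearMap.norm_apply_le x

theorem IsPositive.apply_eq_apply_conj {f : WeakDual ℂ M} (hf : IsPositive f) {q : M}
    (hq : IsStarProjection q) (h : f (1 - q) = 0) (x : M) : f x = f (q * x * q) :=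
  hf.toPositiveLinearMap.apply_eq_apply_conj hq h x

theorem IsPositive.eq_zero {f : WeakDual ℂ M} (hf : IsPositive f) (h : f 1 = 0) : f = 0 := by
  refine DFunLike.ext _ _ fun x => ?_
  have : f x = 0 := by simpa [h] using hf.norm_apply_le x
  exact this

theorem continuous_eval (x : M) : Continuous fun f : WeakDual ℂ M => f x :=
  WeakDual.eval_continuous x

theorem isClosed_states : IsClosed states := by
  have := Complex.orderClosedTopology
  have h : states = (⋂ (a : M) (_ : 0 ≤ a), {f | 0 ≤ f a}) ∩ {f | f 1 = 1} := by
    ext f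
    simp [states, IsPositive]
  rw [h]
  refine (isClosed_biInter fun a _ => ?_).inter ?_
  · exact isClosed_le continuous_const (continuous_eval a)
  · exact isClosed_eq (continuous_eval 1) continuous_const

theorem isCompact_states : IsCompact states := by
  refine (WeakDual.isCompact_closedBall (𝕜 := ℂ) (E := M) 0 1).of_isClosed_subset
    isClosed_states fun f hf => ?_
  simp only [Set.mem_preimage, mem_closedBall_zero_iff]
  refine ContinuousLinearMap.opNorm_le_bound _ zero_le_one fun x => ?_
  simpa [hf.2] using hf.1.norm_apply_le x

theorem convex_states : Convex ℝ states := by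
  intro f hf g hg s t hs ht hst
  refine ⟨fun a ha => ?_, ?_⟩
  · have h1 := hf.1 a ha
    have h2 := hg.1 a ha
    change 0 ≤ s • f a + t • g a
    positivity
  · change s • f 1 + t • g 1 = 1
    rw [hf.2, hg.2, ← add_smul, hst, one_smul]

/-- The functional `x ↦ ⟨x_n v, v⟩`. -/
def vectorFunctional (n : ℕ) (v : Fin (n + 1) → ℂ) : WeakDual ℂ M :=
  StrongDual.toWeakDual <| ContinuousLinearMap.mk
    { toFun := fun x => star v ⬝ᵥ (M.coord n x).mulVec v
      map_add' := by simp [Matrix.add_mulVec]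
      map_smul' := by simp [Matrix.smul_mulVec] } <| by
    have h : Continuous (M.coord n) := M.continuous_coord n
    have h' : Continuous fun A : Matrix (Fin (n + 1)) (Fin (n + 1)) ℂ => star v ⬝ᵥ A.mulVec v := by
      fun_prop
    exact h'.comp h

theorem vectorFunctional_apply (n : ℕ) (v : Fin (n + 1) → ℂ) (x : M) :
    vectorFunctional n v x = star v ⬝ᵥ (M.coord n x).mulVec v := rfl

theorem vectorFunctional_mem_states {n : ℕ} {v : Fin (n + 1) → ℂ} (hv : star v ⬝ᵥ v = 1) :
    vectorFunctional n v ∈ states :=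
  ⟨fun _ ha => (M.posSemidef_coord ha n).dotProduct_mulVec_nonneg v,
    by simpa [vectorFunctional_apply] using hv⟩

/-- The weak* limits of vector states along nonprincipal ultrafilters. -/
def vectorLimitStates : Set (WeakDual ℂ M) :=
  {g | ∃ (U : Ultrafilter ℕ) (v : ∀ n : ℕ, Fin (n + 1) → ℂ), (U : Filter ℕ) ≤ cofinite ∧
    (∀ n, star (v n) ⬝ᵥ v n = 1) ∧
    Tendsto (fun n => vectorFunctional n (v n)) U (𝓝 g)}

theorem vectorLimitStates_subset_states : vectorLimitStates ⊆ states := by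
  rintro g ⟨U, v, -, hv, h⟩
  exact isClosed_states.mem_of_tendsto h
    (Eventually.of_forall fun n => vectorFunctional_mem_states (hv n))

theorem exists_tendsto_vectorFunctional (U : Ultrafilter ℕ) {v : ∀ n : ℕ, Fin (n + 1) → ℂ}
    (hv : ∀ n, star (v n) ⬝ᵥ v n = 1) :
    ∃ g, Tendsto (fun n => vectorFunctional n (v n)) U (𝓝 g) := by
  obtain ⟨g, -, hg⟩ := isCompact_states.ultrafilter_le_nhds
    (U.map fun n => vectorFunctional n (v n))
    (tendsto_principal.2 (Eventually.of_forall fun n => vectorFunctional_mem_states (hv n)))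
  exact ⟨g, hg⟩

theorem closedConvexHull_vectorLimitStates_subset :
    closedConvexHull ℝ vectorLimitStates ⊆ states :=
  closedConvexHull_min vectorLimitStates_subset_states convex_states isClosed_states

/-- The rank-one projections onto the lines of the unit vectors `v n`. -/
def rankOneProj (v : ∀ n : ℕ, Fin (n + 1) → ℂ) (hv : ∀ n, star (v n) ⬝ᵥ v n = 1) : M :=
  M.ofBounded (fun n => Matrix.vecMulVec (v n) (star (v n))) 1 fun n => by
    refine IsStarProjection.norm_le _ ⟨?_, ?_⟩
    · simp [IsIdempotentElem, Matrix.vecMulVec_mul_vecMulVec, hv]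
    · simp [IsSelfAdjoint, Matrix.star_eq_conjTranspose, Matrix.conjTranspose_vecMulVec]

theorem isStarProjection_rankOneProj {v : ∀ n : ℕ, Fin (n + 1) → ℂ}
    (hv : ∀ n, star (v n) ⬝ᵥ v n = 1) : IsStarProjection (rankOneProj v hv) := by
  constructor
  · refine M.ext fun n => ?_
    simp [rankOneProj, Matrix.vecMulVec_mul_vecMulVec, hv]
  · refine M.ext fun n => ?_
    simp [rankOneProj, map_star, Matrix.star_eq_conjTranspose, Matrix.conjTranspose_vecMulVec]

/-- This scalar compression makes the projection abelian and drives the purity of the limit states.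
-/
theorem coord_rankOneProj_conj {v : ∀ n : ℕ, Fin (n + 1) → ℂ}
    (hv : ∀ n, star (v n) ⬝ᵥ v n = 1) (x : M) (n : ℕ) :
    M.coord n (rankOneProj v hv * x * rankOneProj v hv) =
      vectorFunctional n (v n) x • M.coord n (rankOneProj v hv) := by
  simp [rankOneProj, vectorFunctional_apply, Matrix.vecMulVec_mul, Matrix.mul_vecMulVec,
    Matrix.vecMulVec_mulVec, Matrix.dotProduct_mulVec]

theorem isAbelianProjection_rankOneProj {v : ∀ n : ℕ, Fin (n + 1) → ℂ}
    (hv : ∀ n, star (v n) ⬝ᵥ v n = 1) : IsAbelianProjection (rankOneProj v hv) := by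
  refine ⟨isStarProjection_rankOneProj hv, fun x y => M.ext fun n => ?_⟩
  rw [map_mul _ (_ * _ * _), map_mul _ (_ * _ * _), coord_rankOneProj_conj, coord_rankOneProj_conj, smul_mul_smul_comm,
    smul_mul_smul_comm, mul_comm]

theorem vectorFunctional_rankOneProj {v : ∀ n : ℕ, Fin (n + 1) → ℂ}
    (hv : ∀ n, star (v n) ⬝ᵥ v n = 1) (n : ℕ) :
    vectorFunctional n (v n) (rankOneProj v hv) = 1 := by
  simp [rankOneProj, vectorFunctional_apply, Matrix.vecMulVec_mulVec, hv]

end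

end KadisonSinger

/-! ### Limits of vector states are pure and singular -/

namespace KadisonSinger

noncomputable section

open Filter Topology

theorem tendsto_apply {U : Ultrafilter ℕ} {v : ∀ n : ℕ, Fin (n + 1) → ℂ} {g : WeakDual ℂ M}
    (h : Tendsto (fun n => vectorFunctional n (v n)) U (𝓝 g)) (x : M) :
    Tendsto (fun n => vectorFunctional n (v n) x) U (𝓝 (g x)) :=
  ((continuous_eval x).tendsto g).comp h

/-- A component `h₁` of `g` inherits the vanishing at `1 - q`, so it sees only `q * x * q`, which
lies within `ε` of `g x • q`. -/
theorem vectorLimitStates_subset_pureStates : vectorLimitStates ⊆ pureStates := by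
  intro g hg
  refine mem_extremePoints_iff_left.2 ⟨vectorLimitStates_subset_states hg, ?_⟩
  rintro h₁ hh₁ h₂ hh₂ ⟨s, t, hs, ht, -, hst⟩
  obtain ⟨U, v, -, hv, hlim⟩ := hg
  have hp := isStarProjection_rankOneProj hv
  set p := rankOneProj v hv with hp_def
  refine DFunLike.ext _ _ fun x => ?_
  refine eq_of_forall_dist_le fun ε hε => ?_
  rw [dist_eq_norm]
  -- Cutting down to `A`, a set in the ultrafilter, turns convergence at `x` into a norm estimate
  -- over all coordinates.
  set A : Set ℕ := {n | ‖vectorFunctional n (v n) x - g x‖ ≤ ε}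
  have hA : ∀ᶠ n in (U : Filter ℕ), n ∈ A := by
    filter_upwards [(tendsto_apply hlim x).eventually (Metric.closedBall_mem_nhds _ hε)] with n hn
    rwa [dist_eq_norm] at hn
  set q : M := M.centralProj A * p
  have hq : IsStarProjection q :=
    (M.isStarProjection_centralProj A).mul hp (M.centralProj_mul_comm A p)
  have hgq : g (1 - q) = 0 := by
    refine tendsto_nhds_unique (tendsto_apply hlim _) (tendsto_const_nhds.congr' ?_)
    filter_upwards [hA] with n hn
    have h1 : vectorFunctional n (v n) q = 1 := by
      rw [← vectorFunctional_rankOneProj hv n]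
      simp only [vectorFunctional_apply, q, map_mul, M.coord_centralProj_of_mem hn, one_mul, p]
    rw [map_sub, h1, (vectorFunctional_mem_states (hv n)).2, sub_self]
  have hh₁q : h₁ (1 - q) = 0 := by
    have e1 := hh₁.1 _ hq.one_sub.nonneg
    have e2 := hh₂.1 _ hq.one_sub.nonneg
    have e : s • h₁ (1 - q) + t • h₂ (1 - q) = 0 := by
      rw [← hgq, ← hst]; rfl
    rw [add_eq_zero_iff_of_nonneg (smul_nonneg hs.le e1) (smul_nonneg ht.le e2)] at e
    exact (smul_eq_zero.1 e.1).resolve_left hs.ne'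
  have h1q : h₁ q = 1 := by
    rw [map_sub, hh₁.2, sub_eq_zero] at hh₁q
    exact hh₁q.symm
  have key : h₁ x - g x = h₁ (q * x * q - g x • q) := by
    rw [map_sub, ← hh₁.1.apply_eq_apply_conj hq hh₁q, map_smul, h1q, smul_eq_mul, mul_one]
  rw [key]
  refine (hh₁.1.norm_apply_le _).trans ?_
  rw [hh₁.2, norm_one, one_mul]
  refine M.norm_le fun n => ?_
  by_cases hn : n ∈ A
  · have e : M.coord n (q * x * q - g x • q) =
        (vectorFunctional n (v n) x - g x) • M.coord n p := by
      rw [sub_smul, hp_def, ← coord_rankOneProj_conj hv]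
      simp [q, M.coord_centralProj_of_mem hn, p]
    rw [e, norm_smul]
    calc _ ≤ ε * 1 := by
          gcongr
          · exact hn
          · exact (M.norm_coord_le p n).trans hp.norm_le
      _ = ε := mul_one ε
  · have e : M.coord n (q * x * q - g x • q) = 0 := by
      simp [q, M.coord_centralProj_of_notMem hn]
    rw [e, norm_zero]
    exact hε.le

theorem isLUB_range_centralProj_Iio : IsLUB (Set.range fun N => M.centralProj (Set.Iio N)) 1 := by
  constructor
  · rintro _ ⟨N, rfl⟩
    exact (M.isStarProjection_centralProj _).le_one
  · intro b hb
    rw [← sub_nonneg]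
    refine M.nonneg_of_posSemidef fun n => ?_
    have h := M.posSemidef_coord (sub_nonneg.2 (hb ⟨n + 1, rfl⟩)) n
    rwa [map_sub, M.coord_centralProj_of_mem (by simp), ← map_one (M.coord n), ← map_sub] at h

theorem monotone_centralProj : Monotone M.centralProj := by
  intro s t hst
  rw [← sub_nonneg]
  refine M.nonneg_of_posSemidef fun n => ?_
  rw [map_sub]
  by_cases hs : n ∈ s
  · simpa [M.coord_centralProj_of_mem hs, M.coord_centralProj_of_mem (hst hs)] using
      Matrix.PosSemidef.zero
  · rw [M.coord_centralProj_of_notMem hs, sub_zero]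
    exact M.posSemidef_coord (M.isStarProjection_centralProj t).nonneg n

/-- A positive minorant of `g` also kills the finite central projections; these increase to 1, so
normality forces it to vanish. -/
theorem isSingular_of_mem_vectorLimitStates {g : WeakDual ℂ M} (hg : g ∈ vectorLimitStates) :
    IsSingular g := by
  intro h hpos hnormal hle
  obtain ⟨U, v, hU, hv, hlim⟩ := hg
  have hz (N : ℕ) : h (M.centralProj (Set.Iio N)) = 0 := by
    have hgz : g (M.centralProj (Set.Iio N)) = 0 := by
      refine tendsto_nhds_unique (tendsto_apply hlim _) (tendsto_const_nhds.congr' ?_)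
      filter_upwards [hU (Set.finite_Iio N).compl_mem_cofinite] with n hn
      simp [vectorFunctional_apply, M.coord_centralProj_of_notMem hn]
    have hnn := (M.isStarProjection_centralProj (Set.Iio N)).nonneg
    refine le_antisymm ?_ (hpos _ hnn)
    rw [← hgz]
    exact sub_nonneg.1 (hle _ hnn)
  have hlub := hnormal _ 1 (Set.range_nonempty _)
    (monotone_centralProj.comp fun _ _ h => Set.Iio_subset_Iio h).directed_le.directedOn_range
    isLUB_range_centralProj_Iio
  refine hpos.eq_zero (le_antisymm (hlub.2 ?_) (hpos _ zero_le_one))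
  rintro _ ⟨_, ⟨N, rfl⟩, rfl⟩
  exact (hz N).le

/-! ### Singular functionals vanish on each summand -/

/-- The restriction of a functional to the `n`-th summand of `M`. -/
def summandFunctional (f : WeakDual ℂ M) (n : ℕ) : WeakDual ℂ M :=
  StrongDual.toWeakDual <|
    (WeakDual.toStrongDual f).comp (ContinuousLinearMap.mul ℂ M (M.centralProj {n}))

theorem summandFunctional_apply (f : WeakDual ℂ M) (n : ℕ) (x : M) :
    summandFunctional f n x = f (M.centralProj {n} * x) := rfl

theorem isPositive_summandFunctional {f : WeakDual ℂ M} (hf : IsPositive f) (n : ℕ) :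
    IsPositive (summandFunctional f n) :=
  fun _ ha => hf _ (M.centralProj_mul_nonneg _ ha)

theorem isPositive_sub_summandFunctional {f : WeakDual ℂ M} (hf : IsPositive f) (n : ℕ) :
    IsPositive (f - summandFunctional f n) := by
  intro a ha
  have h := hf _ (M.centralProj_mul_nonneg {n}ᶜ ha)
  rw [← sub_eq_of_eq_add' (M.centralProj_add_compl {n}).symm, sub_mul, one_mul, map_sub] at h
  exact h

/-- The summand is finite-dimensional, so the directed set has a norm limit point there, and `f` is
norm continuous. -/
theorem isNormal_summandFunctional {f : WeakDual ℂ M} (hf : IsPositive f) (n : ℕ) :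
    IsNormal (summandFunctional f n) := by
  have := Complex.orderClosedTopology
  have hpos := isPositive_summandFunctional hf n
  intro S a hne hdir hlub
  refine ⟨?_, fun c hc => ?_⟩
  · rintro _ ⟨x, hx, rfl⟩
    exact hpos.mono (hlub.1 hx)
  obtain ⟨s₀, hs₀⟩ := hne
  have : Nonempty S := ⟨⟨s₀, hs₀⟩⟩
  have : IsDirectedOrder S := ⟨fun x y => by
    obtain ⟨z, hz, hxz, hyz⟩ := hdir x x.2 y y.2
    exact ⟨⟨z, hz⟩, hxz, hyz⟩⟩
  set e := M.centralProj {n}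
  set U : Ultrafilter S := Ultrafilter.of atTop
  have hU (s : S) : ∀ᶠ t in (U : Filter S), s ≤ t :=
    Ultrafilter.of_le atTop (eventually_ge_atTop s)
  -- Beyond `s₀` one has `0 ≤ e * (a - t) ≤ e * (a - s₀)`, which gives the radius.
  obtain ⟨L, -, hL⟩ : ∃ L ∈ M.single n '' Metric.closedBall (M.coord n a) ‖e * (a - s₀)‖,
      Tendsto (fun t : S => e * t.1) U (𝓝 L) := by
    refine ((isCompact_closedBall _ _).image (M.continuous_single n)).ultrafilter_le_nhds
      (U.map fun t : S => e * t.1) (tendsto_principal.2 ?_)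
    filter_upwards [hU ⟨s₀, hs₀⟩] with t ht
    refine ⟨M.coord n t.1, ?_, M.single_coord n t.1⟩
    rw [mem_closedBall_iff_norm', ← map_sub]
    have h1 : M.coord n (a - t.1) = M.coord n (e * (a - t.1)) := by
      rw [map_mul, M.coord_centralProj_of_mem (Set.mem_singleton n), one_mul]
    rw [h1]
    refine (M.norm_coord_le _ n).trans (CStarAlgebra.norm_le_norm_of_nonneg_of_le
      (M.centralProj_mul_nonneg _ (sub_nonneg.2 (hlub.1 t.2))) ?_)
    rw [← sub_nonneg, ← mul_sub]
    refine M.centralProj_mul_nonneg _ ?_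
    rw [sub_sub_sub_cancel_left, sub_nonneg]
    exact ht
  have hmono {x y : M} (s : Set ℕ) (h : x ≤ y) : M.centralProj s * x ≤ M.centralProj s * y := by
    rw [← sub_nonneg, ← mul_sub]
    exact M.centralProj_mul_nonneg _ (sub_nonneg.2 h)
  have hsplit (x : M) : x = e * x + M.centralProj {n}ᶜ * x := by
    rw [← add_mul, M.centralProj_add_compl, one_mul]
  -- Gluing `L` to the other coordinates of `a` gives an upper bound in `M`, to compare with the
  -- supremum `a`.
  have hub : L + M.centralProj {n}ᶜ * a ∈ upperBounds S := by
    intro s hs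
    rw [hsplit s]
    refine add_le_add (ge_of_tendsto hL ?_) (hmono _ (hlub.1 hs))
    filter_upwards [hU ⟨s, hs⟩] with t ht
    exact hmono _ ht
  have hle : e * a ≤ L :=
    le_of_add_le_add_right ((hsplit a).symm.trans_le (hlub.2 hub))
  have hfL : f L ≤ c := by
    refine le_of_tendsto (((map_continuous f).tendsto L).comp hL) (Eventually.of_forall fun t => ?_)
    exact hc ⟨t.1, t.2, rfl⟩
  exact (hf.mono hle).trans hfL

theorem IsSingular.apply_centralProj_singleton {f : WeakDual ℂ M} (hf : IsPositive f)
    (hs : IsSingular f) (n : ℕ) : f (M.centralProj {n}) = 0 := by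
  have h := hs _ (isPositive_summandFunctional hf n) (isNormal_summandFunctional hf n)
    (isPositive_sub_summandFunctional hf n)
  have h1 : summandFunctional f n 1 = 0 := by rw [h]; rfl
  simpa [summandFunctional_apply] using h1

end

end KadisonSinger

/-! ### Singular states lie in the closed convex hull of the limits -/

theorem Matrix.IsHermitian.exists_unit_re_dotProduct_neg {n : Type*} [Fintype n]
    {A : Matrix n n ℂ} (hA : A.IsHermitian) (h : ¬ A.PosSemidef) :
    ∃ v : n → ℂ, star v ⬝ᵥ v = 1 ∧ (star v ⬝ᵥ A.mulVec v).re < 0 := by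
  by_contra! H
  refine h (.of_dotProduct_mulVec_nonneg hA fun w => ?_)
  rcases eq_or_ne w 0 with rfl | hw
  · simp
  have hpos : 0 < star w ⬝ᵥ w := dotProduct_star_self_pos_iff.2 hw
  obtain ⟨r, hr, hrw⟩ : ∃ r : ℝ, 0 < r ∧ star w ⬝ᵥ w = (r : ℂ) :=
    ⟨(star w ⬝ᵥ w).re, hpos.1, Complex.ext rfl hpos.2.symm⟩
  set c : ℂ := (((√r)⁻¹ : ℝ) : ℂ) with hc
  have hcc : star c * c = ((r⁻¹ : ℝ) : ℂ) := by
    rw [hc, Complex.star_def, Complex.conj_ofReal, ← Complex.ofReal_mul, ← mul_inv,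
      Real.mul_self_sqrt hr.le]
  have h1 := H (c • w) (by
    rw [star_smul, smul_dotProduct, dotProduct_smul, smul_smul, hcc, hrw, smul_eq_mul,
      ← Complex.ofReal_mul, inv_mul_cancel₀ hr.ne', Complex.ofReal_one])
  rw [star_smul, Matrix.mulVec_smul, smul_dotProduct, dotProduct_smul, smul_smul, hcc,
    smul_eq_mul, Complex.re_ofReal_mul] at h1
  rw [Complex.nonneg_iff]
  exact ⟨nonneg_of_mul_nonneg_right h1 (inv_pos.2 hr), (hA.im_star_dotProduct_mulVec_self w).symm⟩

namespace KadisonSinger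

noncomputable section

open Filter Topology

theorem IsPositive.apply_star {f : WeakDual ℂ M} (hf : IsPositive f) (x : M) :
    f (star x) = star (f x) :=
  map_star hf.toPositiveLinearMap x

theorem centralProj_insert {n : ℕ} {s : Set ℕ} (h : n ∉ s) :
    M.centralProj (insert n s) = M.centralProj {n} + M.centralProj s := by
  refine M.ext fun k => ?_
  rw [map_add]
  rcases eq_or_ne k n with rfl | hk
  · simp [M.centralProj, h]
  · have hk' : k ∉ ({n} : Set ℕ) := hk
    by_cases hs : k ∈ s
    · rw [M.coord_centralProj_of_mem (Set.mem_insert_of_mem n hs), M.coord_centralProj_of_mem hs,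
        M.coord_centralProj_of_notMem hk', zero_add]
    · rw [M.coord_centralProj_of_notMem hs, M.coord_centralProj_of_notMem hk',
        M.coord_centralProj_of_notMem fun h => h.elim hk hs, zero_add]

theorem IsSingular.apply_centralProj_of_finite {f : WeakDual ℂ M} (hf : IsPositive f)
    (hs : IsSingular f) {s : Set ℕ} (h : s.Finite) : f (M.centralProj s) = 0 := by
  induction s, h using Set.Finite.induction_on with
  | empty =>
    have : M.centralProj ∅ = 0 := M.ext fun n => by simp [M.centralProj]
    rw [this, map_zero]
  | insert hn _ ih =>
    rw [centralProj_insert hn, map_add, ih, hs.apply_centralProj_singleton hf, add_zero]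

theorem exists_unit_vector (n : ℕ) : ∃ v : Fin (n + 1) → ℂ, star v ⬝ᵥ v = 1 :=
  ⟨Pi.single 0 1, by simp⟩

/-- If every limit of vector states has positive real part at a self-adjoint `c`, then all but
finitely many coordinates of `c` are positive. -/
theorem eventually_posSemidef_coord {c : M} (hc : IsSelfAdjoint c)
    (h : ∀ g ∈ vectorLimitStates, 0 < (g c).re) :
    ∀ᶠ n in cofinite, (M.coord n c).PosSemidef := by
  by_contra hev
  set B : Set ℕ := {n | ¬ (M.coord n c).PosSemidef}
  have hv (n : ℕ) : ∃ v : Fin (n + 1) → ℂ, star v ⬝ᵥ v = 1 ∧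
      (n ∈ B → (vectorFunctional n v c).re < 0) := by
    by_cases hn : n ∈ B
    · have hherm : (M.coord n c).IsHermitian := hc.map (M.coord n)
      obtain ⟨v, hv, hv'⟩ := hherm.exists_unit_re_dotProduct_neg hn
      exact ⟨v, hv, fun _ => hv'⟩
    · obtain ⟨v, hv⟩ := exists_unit_vector n
      exact ⟨v, hv, fun h => absurd h hn⟩
  choose v hv hneg using hv
  -- As `B` is infinite, some nonprincipal ultrafilter contains it; the limit along it has real part
  -- at most 0 at `c`.
  have : (cofinite ⊓ 𝓟 B).NeBot := frequently_mem_iff_neBot.1 (not_eventually.1 hev)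
  set U := Ultrafilter.of (cofinite ⊓ 𝓟 B)
  obtain ⟨g, hg⟩ := exists_tendsto_vectorFunctional U hv
  have hU : (U : Filter ℕ) ≤ cofinite ⊓ 𝓟 B := Ultrafilter.of_le _
  refine (h g ⟨U, v, hU.trans inf_le_left, hv, hg⟩).not_ge ?_
  refine le_of_tendsto ((Complex.continuous_re.tendsto _).comp (tendsto_apply hg c)) ?_
  filter_upwards [hU (mem_inf_of_right (mem_principal_self B))] with n hn
  exact (hneg n hn).le

instance : LocallyConvexSpace ℝ (WeakDual ℂ M) :=
  inferInstanceAs (LocallyConvexSpace ℝ (WeakBilin (topDualPairing ℂ M)))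

theorem exists_separating {K : Set (WeakDual ℂ M)} (hconv : Convex ℝ K) (hK : IsClosed K)
    {f : WeakDual ℂ M} (hf : f ∉ K) :
    ∃ (φ : StrongDual ℂ (WeakDual ℂ M)) (u : ℝ), (∀ g ∈ K, (φ g).re < u) ∧ u < (φ f).re := by
  have htower : @IsScalarTower ℝ ℂ (WeakDual ℂ M) _ _ (WeakDual.instModule' ℝ).toSMul :=
    ⟨fun r c f => DFunLike.ext _ _ fun x => smul_assoc r c (f x)⟩
  exact @RCLike.geometric_hahn_banach_closed_point ℂ (WeakDual ℂ M) _ _ (WeakDual.instModule' ℝ)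
    K f _ _ htower _ _ inferInstance hconv hK hf

/-- Weak* continuity lets the Hahn-Banach functional be replaced by an element of `M`. -/
theorem exists_eval_eq (φ : StrongDual ℂ (WeakDual ℂ M)) : ∃ x : M, ∀ f, φ f = f x := by
  obtain ⟨x, hx⟩ := LinearMap.dualEmbedding_surjective (topDualPairing ℂ M) φ
  exact ⟨x, fun f => (DFunLike.congr_fun hx f).symm⟩

theorem mem_closedConvexHull_vectorLimitStates {f : WeakDual ℂ M} (hf : f ∈ states)
    (hs : IsSingular f) : f ∈ closedConvexHull ℝ vectorLimitStates := by
  by_contra hcon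
  obtain ⟨φ, u, hu, huf⟩ := exists_separating (convex_closedConvexHull (𝕜 := ℝ) (s := vectorLimitStates))
    isClosed_closedConvexHull hcon
  obtain ⟨x, hx⟩ := exists_eval_eq φ
  -- A state `g` takes the value `2 * (u - (g x).re)` at `c`: positive on the hull, negative at `f`.
  set c : M := ((2 * u : ℝ) : ℂ) • 1 - (x + star x) with hc_def
  have hc : IsSelfAdjoint c := by
    refine IsSelfAdjoint.sub ?_ (IsSelfAdjoint.add_star_self x)
    simp [IsSelfAdjoint]
  have hval {g : WeakDual ℂ M} (hg : g ∈ states) : (g c).re = 2 * (u - (g x).re) := by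
    rw [hc_def, map_sub, map_add, map_smul, hg.1.apply_star, hg.2]
    simp
    ring
  have hev := eventually_posSemidef_coord hc fun g hg => by
    have := hu g (subset_closedConvexHull hg)
    rw [hx] at this
    rw [hval (vectorLimitStates_subset_states hg)]
    exact mul_pos two_pos (sub_pos.2 this)
  have hE := M.isStarProjection_centralProj {n | ¬ (M.coord n c).PosSemidef}
  have hfE : f (1 - (1 - M.centralProj {n | ¬ (M.coord n c).PosSemidef})) = 0 := by
    rw [sub_sub_cancel]
    exact hs.apply_centralProj_of_finite hf.1 hev
  have hfc : 0 ≤ f c := by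
    rw [hf.1.apply_eq_apply_conj hE.one_sub hfE]
    refine hf.1 _ (M.nonneg_of_posSemidef fun n => ?_)
    by_cases hn : (M.coord n c).PosSemidef
    · simpa [M.coord_centralProj_of_notMem (s := {n | ¬ (M.coord n c).PosSemidef}) (n := n)
        (by simpa using hn)] using hn
    · simpa [M.coord_centralProj_of_mem (s := {n | ¬ (M.coord n c).PosSemidef}) (n := n) hn] using
        Matrix.PosSemidef.zero
  have h1 := hfc.1
  rw [hval hf, Complex.zero_re] at h1
  rw [hx] at huf
  linarith

/-- Every singular pure state is a weak* limit of limits of vector states. -/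
theorem singularPureStates_subset_closure : singularPureStates ⊆ closure vectorLimitStates := by
  rintro f ⟨hpure, hs⟩
  have hcl : closedConvexHull ℝ (closure vectorLimitStates) =
      closedConvexHull ℝ vectorLimitStates := closedConvexHull_closure_eq_closedConvexHull
  refine extremePoints_closedConvexHull_subset
    (isCompact_states.of_isClosed_subset isClosed_closure
      (closure_minimal vectorLimitStates_subset_states isClosed_states)) ?_ ?_
  · rw [hcl]
    exact isCompact_states.of_isClosed_subset isClosed_closedConvexHull
      closedConvexHull_vectorLimitStates_subset
  · rw [hcl]
    exact inter_extremePoints_subset_extremePoints_of_subset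
      closedConvexHull_vectorLimitStates_subset
      ⟨mem_closedConvexHull_vectorLimitStates hpure.1 hs, hpure⟩

theorem exists_mem_Iab_apply_ne_zero {g : WeakDual ℂ M} (hg : g ∈ vectorLimitStates) :
    ∃ x ∈ Iab, g x ≠ 0 := by
  obtain ⟨U, v, -, hv, hlim⟩ := hg
  refine ⟨rankOneProj v hv, subset_closure
    (TwoSidedIdeal.subset_span (isAbelianProjection_rankOneProj hv)), ?_⟩
  have h : g (rankOneProj v hv) = 1 :=
    tendsto_nhds_unique (tendsto_apply hlim _)
      (tendsto_const_nhds.congr fun n => (vectorFunctional_rankOneProj hv n).symm)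
  rw [h]
  exact one_ne_zero

end

end KadisonSinger

theorem theorem3p6 :
    IsOpen {f : KadisonSinger.singularPureStates |
      ∃ x ∈ KadisonSinger.Iab, (f : WeakDual ℂ KadisonSinger.M) x ≠ 0} ∧
    Dense {f : KadisonSinger.singularPureStates |
      ∃ x ∈ KadisonSinger.Iab, (f : WeakDual ℂ KadisonSinger.M) x ≠ 0} := by
  constructor
  · have h : {f : KadisonSinger.singularPureStates |
        ∃ x ∈ KadisonSinger.Iab, (f : WeakDual ℂ KadisonSinger.M) x ≠ 0} =
        ⋃ x ∈ KadisonSinger.Iab,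
          {f : KadisonSinger.singularPureStates | (f : WeakDual ℂ KadisonSinger.M) x ≠ 0} := by
      ext f
      simp
    rw [h]
    exact isOpen_biUnion fun x _ => isOpen_ne_fun
      ((KadisonSinger.continuous_eval x).comp continuous_subtype_val) continuous_const
  · rw [Subtype.dense_iff]
    refine KadisonSinger.singularPureStates_subset_closure.trans (closure_mono fun g hg => ?_)
    exact ⟨⟨g, KadisonSinger.vectorLimitStates_subset_pureStates hg,
      KadisonSinger.isSingular_of_mem_vectorLimitStates hg⟩,
      KadisonSinger.exists_mem_Iab_apply_ne_zero hg, rfl⟩
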